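/- \textbf{Setting.} Let $n,K\ge 1$. Let $W_1,\dots,W_K\sim P^{\mathcal O}=\mathcal N(\mu_0,\Sigma_0)$ with $\mu_0\in\mathbb R^n$, $\Sigma_0=\mathrm{diag}(\sigma_1^2,\dots,\sigma_n^2)$, $\sigma_i>0$ (the unprotected parameters of $K$ clients), and let $e_1,\dots,e_K\sim\mathcal N(0,\sigma_\epsilon^2 I_n)$, $\sigma_\epsilon\ge 0$ (the noises), all these $2K$ random vectors being independent. Client $k$ releases $W_k+e_k$, with distribution $P_k^{\mathcal S}$; write $P_k^{\mathcal O}=P^{\mathcal O}$. Let $P_a^{\mathcal O}$ and $P_a^{\mathcal S}$ be the distributions of $\frac1K\sum_k W_k$ and $\frac1K\sum_k (W_k+e_k)$. Put $$h(\sigma_\epsilon)=\sigma_\epsilon^2\sqrt{\sum_{i=1}^n \frac1{\sigma_i^4}} .$$ \textbf{Privacy leakage.} For each $k$ let $\mathcal D_k$ be a measurable set of data sets (non-empty finite families of data points) with a $\sigma$-finite reference measure $\mu_k$; let $f_{D_k}$ be a probability density with respect to $\mu_k$, positive on $\mathcal D_k$ (the adversary's prior), and let $f_{D_k|W_k}(\cdot\,|\,w)$,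 $w\in\mathbb R^n$, be probability densities on $\mathcal D_k$, jointly measurable in $(d,w)$ (the adversary's conditional belief). For a distribution $P$ on $\mathbb R^n$ let $F_k^{P}$ have the density $d\mapsto\int f_{D_k|W_k}(d\,|\,w)\,dP(w)$ and let $F_k^{\mathcal B}$ have the density $f_{D_k}$. Put $$\epsilon_p=\frac1K\sum_{k=1}^K\sqrt{\mathrm{JS}(F_k^{P_k^{\mathcal S}}\|F_k^{\mathcal B})},\qquad C_1=\frac1K\sum_{k=1}^K\sqrt{\mathrm{JS}(F_k^{P_k^{\mathcal O}}\|F_k^{\mathcal B})},\qquad C_3=\frac{e^{2\xi}-1}2,$$ where $\mathrm{JS}(F\|G)=\frac12\mathrm{KL}(F\|M)+\frac12\mathrm{KL}(G\|M)$ with $M=\frac12(F+G)$ is the Jensen--Shannon divergence, and $$\xi=\max_k\ \sup_{w\in\mathbb R^n,\,d\in\mathcal D_k}\left|\log\frac{f_{D_k|W_k}(d|w)}{f_{D_k}(d)}\right|$$ is assumed to be finite. \textbf{Utility loss.} Let $U(w,x)\in[0,C_4]$ be a measurable utility of the parameter $w$ at the data point $x$, and let the data set $D_k$ have distribution $P_k$.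 Put $U_k(P)=\mathbb E_{D_k\sim P_k}\mathbb E_{W\sim P}\frac1{|D_k|}\sum_{x\in D_k}U(W,x)$ and $\epsilon_u=\frac1K\sum_{k=1}^K[U_k(P_a^{\mathcal O})-U_k(P_a^{\mathcal S})]$. \textbf{Proposition.} If $h(\sigma_\epsilon)\le 1$, then \begin{itemize} \item $\epsilon_p\ge C_1-C_3\,h(\sigma_\epsilon)$, and this lower bound is a decreasing function of $\sigma_\epsilon\in[0,\infty)$ (strictly decreasing if $\xi>0$); \item $\epsilon_u\le C_4\,h(\sigma_\epsilon)$, and this upper bound is an increasing function of $\sigma_\epsilon\in[0,\infty)$ (strictly increasing if $C_4>0$). \end{itemize} -/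

import Mathlib

open MeasureTheory ProbabilityTheory

noncomputable section

namespace PrivacyUtility

/-- Model parameters: vectors of `ℝⁿ`. -/
abbrev Param (n : ℕ) : Type := EuclideanSpace ℝ (Fin n)

/-- A data set: a non-empty finite family of data points. The set of data sets carries the
measurable structure of a disjoint union of finite powers of `X`. -/
abbrev Dataset (X : Type*) : Type _ := Σ m : ℕ, (Fin (m + 1) → X)

/-- The average `|D|⁻¹ ∑_{x ∈ D} g x` of a function over a data set. -/
def dataAverage {X : Type*} (g : X → ℝ) (D : Dataset X) : ℝ :=
  ((D.1 : ℝ) + 1)⁻¹ * ∑ j, g (D.2 j)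

/-- The beliefs of a Bayesian adversary about the private data set of one client: a measurable
set `carrier` of data sets (the possible values of the private data set), a `σ`-finite reference
measure on it, a prior density `f_D`, strictly positive on `carrier`, and for every parameter `w`
a conditional density `f_{D|W}(· | w)`. The value `posterior w d` is `f_{D|W}(d | w)`. -/
structure Adversary (n : ℕ) (X : Type*) [MeasurableSpace X] where
  carrier : Set (Dataset X)
  ref : Measure (Dataset X)
  prior : Dataset X → ℝ
  posterior : Param n → Dataset X → ℝ
  measurableSet_carrier : MeasurableSet carrier
  sigmaFinite_ref : SigmaFinite ref
  measurable_prior : Measurable prior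
  prior_pos : ∀ d ∈ carrier, 0 < prior d
  integral_prior : ∫ d in carrier, prior d ∂ref = 1
  measurable_posterior : Measurable (Function.uncurry posterior)
  posterior_nonneg : ∀ w, ∀ d ∈ carrier, 0 ≤ posterior w d
  integral_posterior : ∀ w, ∫ d in carrier, posterior w d ∂ref = 1

/-- The Jensen-Shannon divergence of two distributions with densities `f` and `g`
with respect to `ν`. -/
def jsDiv {S : Type*} [MeasurableSpace S] (ν : Measure S) (f g : S → ℝ) : ℝ :=
  1 / 2 * ∫ d, f d * Real.log (f d / ((f d + g d) / 2)) ∂ν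
    + 1 / 2 * ∫ d, g d * Real.log (g d / ((f d + g d) / 2)) ∂ν

section Leakage

variable {n K : ℕ} {X : Type*} [MeasurableSpace X]

/-- The density `d ↦ ∫ f_{D|W}(d | w) dP(w)` of the adversary's belief about the private data set
when the model information is released with distribution `P`. -/
def Adversary.belief (a : Adversary n X) (P : Measure (Param n)) (d : Dataset X) : ℝ :=
  ∫ w, a.posterior w d ∂P

/-- The square root of the Jensen-Shannon divergence between the belief upon observing model
information with distribution `P` and the prior belief. -/
def Adversary.leakage (a : Adversary n X) (P : Measure (Param n)) : ℝ :=
  Real.sqrt (jsDiv (a.ref.restrict a.carrier) (a.belief P) a.prior)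

/-- The average over the `K` clients of the leakage, when client `k` releases model information
with distribution `P k`. For the protected distributions this is the Bayesian privacy leakage
`ε_p`; for the unprotected distributions it is the constant `C₁`. -/
def avgLeakage (A : Fin K → Adversary n X) (P : Fin K → Measure (Param n)) : ℝ :=
  (K : ℝ)⁻¹ * ∑ k, (A k).leakage (P k)

/-- The values `|log (f_{D|W}(d | w) / f_D(d))|`. The parameter `w` ranges over `ℝⁿ`, the support
of every nondegenerate Gaussian distribution. -/
def Adversary.logRatios (a : Adversary n X) : Set ℝ :=
  {r | ∃ w, ∃ d ∈ a.carrier, r = |Real.log (a.posterior w d / a.prior d)|}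

/-- The maximum leakage `ξ_k` is finite. As `log 0 = -∞` in the definition of `ξ_k`, this
includes that the conditional density does not vanish on `carrier`. -/
def Adversary.FiniteXi (a : Adversary n X) : Prop :=
  (∀ w, ∀ d ∈ a.carrier, 0 < a.posterior w d) ∧ BddAbove a.logRatios

/-- The maximum leakage `ξ_k` of one client. -/
def Adversary.xi (a : Adversary n X) : ℝ := sSup a.logRatios

/-- `ξ = max_k ξ_k`. -/
def maxXi (A : Fin K → Adversary n X) : ℝ := ⨆ k, (A k).xi

/-- `C₃ = (e^{2ξ} - 1) / 2`. -/
def constC3 (A : Fin K → Adversary n X) : ℝ := (Real.exp (2 * maxXi A) - 1) / 2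

/-- The expected utility `U_k(P) = E_{D ∼ Q} E_{W ∼ P} |D|⁻¹ ∑_{x ∈ D} U(W, x)`, where `Q` is the
distribution of the data set of client `k`. -/
def expectedUtility (U : Param n → X → ℝ) (Q : Measure (Dataset X)) (P : Measure (Param n)) : ℝ :=
  ∫ D, ∫ w, dataAverage (U w) D ∂P ∂Q

/-- The utility loss `ε_u = K⁻¹ ∑_k (U_k(P_a^O) - U_k(P_a^S))`. -/
def utilityLoss (U : Param n → X → ℝ) (Q : Fin K → Measure (Dataset X))
    (PaO PaS : Measure (Param n)) : ℝ :=
  (K : ℝ)⁻¹ * ∑ k, (expectedUtility U (Q k) PaO - expectedUtility U (Q k) PaS)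

end Leakage

/-- The quantity `s² √(∑ᵢ 1 / σᵢ⁴)`. -/
def noiseLevel {n : ℕ} (σ : Fin n → ℝ) (s : ℝ) : ℝ :=
  s ^ 2 * Real.sqrt (∑ i, 1 / σ i ^ 4)

end PrivacyUtility

end

noncomputable section

namespace PrivacyUtility

lemma integral_mul_add_sq {S : Type*} [MeasurableSpace S] {ν : Measure S} {f g : S → ℝ}
    (hf : MemLp f 2 ν) (hg : MemLp g 2 ν) (t : ℝ) :
    ∫ x, (f x * t + g x) ^ 2 ∂ν = (∫ x, f x ^ 2 ∂ν) * (t * t) + (2 * ∫ x, f x * g x ∂ν) * t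
      + ∫ x, g x ^ 2 ∂ν := by
  have hfg : Integrable (fun x => f x * g x) ν := hf.integrable_mul hg
  have h1 : Integrable (fun x => f x ^ 2 * (t * t)) ν := hf.integrable_sq.mul_const _
  have h2 : Integrable (fun x => f x * g x * (2 * t)) ν := hfg.mul_const _
  have h12 : Integrable (fun x => f x ^ 2 * (t * t) + f x * g x * (2 * t)) ν := h1.add h2
  have : ∀ x, (f x * t + g x) ^ 2 = f x ^ 2 * (t * t) + f x * g x * (2 * t) + g x ^ 2 :=
    fun x => by ring
  simp_rw [this]
  rw [integral_add h12 hg.integrable_sq, integral_add h1 h2, integral_mul_const,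
    integral_mul_const]
  ring

/-- Cauchy–Schwarz for square-integrable real functions. -/
lemma sq_integral_mul_le {S : Type*} [MeasurableSpace S] {ν : Measure S} {f g : S → ℝ}
    (hf : MemLp f 2 ν) (hg : MemLp g 2 ν) :
    (∫ x, f x * g x ∂ν) ^ 2 ≤ (∫ x, f x ^ 2 ∂ν) * ∫ x, g x ^ 2 ∂ν := by
  have h : ∀ t : ℝ, 0 ≤ (∫ x, f x ^ 2 ∂ν) * (t * t) + (2 * ∫ x, f x * g x ∂ν) * t
      + ∫ x, g x ^ 2 ∂ν := fun t => by
    rw [← integral_mul_add_sq hf hg]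
    exact integral_nonneg fun x => sq_nonneg _
  have := discrim_le_zero h
  rw [discrim] at this
  linarith

/-- Minkowski's inequality in `L²` for real functions. -/
lemma sqrt_integral_add_sq_le {S : Type*} [MeasurableSpace S] {ν : Measure S} {f g : S → ℝ}
    (hf : MemLp f 2 ν) (hg : MemLp g 2 ν) :
    Real.sqrt (∫ x, (f x + g x) ^ 2 ∂ν)
      ≤ Real.sqrt (∫ x, f x ^ 2 ∂ν) + Real.sqrt (∫ x, g x ^ 2 ∂ν) := by
  have hA : 0 ≤ ∫ x, f x ^ 2 ∂ν := integral_nonneg fun x => sq_nonneg _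
  have hB : 0 ≤ ∫ x, g x ^ 2 ∂ν := integral_nonneg fun x => sq_nonneg _
  have hC : ∫ x, f x * g x ∂ν ≤ Real.sqrt (∫ x, f x ^ 2 ∂ν) * Real.sqrt (∫ x, g x ^ 2 ∂ν) := by
    rw [← Real.sqrt_mul hA]
    exact Real.le_sqrt_of_sq_le (sq_integral_mul_le hf hg)
  rw [Real.sqrt_le_left (by positivity)]
  have := integral_mul_add_sq hf hg 1
  simp only [mul_one] at this
  rw [this, add_sq, Real.sq_sqrt hA, Real.sq_sqrt hB]
  linarith

/-- The integrand of twice the Jensen–Shannon divergence. -/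
def jsKernel (p q : ℝ) : ℝ :=
  p * Real.log (p / ((p + q) / 2)) + q * Real.log (q / ((p + q) / 2))

lemma jsKernel_comm (p q : ℝ) : jsKernel p q = jsKernel q p := by
  rw [jsKernel, jsKernel, add_comm p q]
  ring

lemma measurable_jsKernel {S : Type*} [MeasurableSpace S] {f g : S → ℝ}
    (hf : Measurable f) (hg : Measurable g) : Measurable fun d => jsKernel (f d) (g d) := by
  unfold jsKernel
  fun_prop

lemma jsKernel_le {p q : ℝ} (hp : 0 < p) (hq : 0 < q) :
    jsKernel p q ≤ (p - q) ^ 2 / (p + q) := by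
  have h1 := Real.log_le_sub_one_of_pos (show 0 < p / ((p + q) / 2) by positivity)
  have h2 := Real.log_le_sub_one_of_pos (show 0 < q / ((p + q) / 2) by positivity)
  calc jsKernel p q ≤ p * (p / ((p + q) / 2) - 1) + q * (q / ((p + q) / 2) - 1) := by
        unfold jsKernel; gcongr
    _ = (p - q) ^ 2 / (p + q) := by field_simp; ring

/-- The integral `∫ₚ^q e^{-ts} ds`. -/
def expInt (p q t : ℝ) : ℝ := ∫ s in p..q, Real.exp (-(t * s))

lemma expInt_add (p r q t : ℝ) : expInt p r t + expInt r q t = expInt p q t :=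
  intervalIntegral.integral_add_adjacent_intervals
    (Continuous.intervalIntegrable (by fun_prop) _ _)
    (Continuous.intervalIntegrable (by fun_prop) _ _)

lemma integrable_exp_prod {p q : ℝ} (hp : 0 < p) :
    Integrable (fun z : ℝ × (ℝ × ℝ) => Real.exp (-(z.1 * (z.2.1 + z.2.2))))
      ((volume.restrict (Set.Ioi 0)).prod
        ((volume.restrict (Set.Ioc p q)).prod (volume.restrict (Set.Ioc p q)))) := by
  have h1 : Integrable (fun t : ℝ => Real.exp (-(2 * p) * t)) (volume.restrict (Set.Ioi 0)) :=
    exp_neg_integrableOn_Ioi 0 (by positivity)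
  have h2 : Integrable (fun _ : ℝ × ℝ => (1 : ℝ))
    ((volume.restrict (Set.Ioc p q)).prod (volume.restrict (Set.Ioc p q))) := integrable_const _
  refine (h1.mul_prod h2).mono' (by fun_prop) ?_
  rw [Measure.prod_restrict, Measure.prod_restrict]
  filter_upwards [ae_restrict_mem
    (measurableSet_Ioi.prod (measurableSet_Ioc.prod measurableSet_Ioc))] with z hz
  obtain ⟨hz0, hz1, hz2⟩ := hz
  simp only [Set.mem_Ioi, Set.mem_Ioc] at hz0 hz1 hz2
  rw [Real.norm_eq_abs, abs_of_pos (Real.exp_pos _), mul_one]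
  refine Real.exp_le_exp.2 ?_
  nlinarith [mul_nonneg hz0.le (by linarith : 0 ≤ z.2.1 + z.2.2 - 2 * p)]

lemma expInt_sq {p q : ℝ} (hpq : p ≤ q) (t : ℝ) :
    expInt p q t ^ 2 = ∫ z : ℝ × ℝ, Real.exp (-(t * (z.1 + z.2)))
      ∂((volume.restrict (Set.Ioc p q)).prod (volume.restrict (Set.Ioc p q))) := by
  have : ∀ z : ℝ × ℝ, Real.exp (-(t * (z.1 + z.2)))
      = Real.exp (-(t * z.1)) * Real.exp (-(t * z.2)) := fun z => by
    rw [← Real.exp_add]; ring_nf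
  simp_rw [this]
  rw [integral_prod_mul (fun s => Real.exp (-(t * s))) (fun s => Real.exp (-(t * s))), expInt,
    intervalIntegral.integral_of_le hpq, sq]

lemma continuous_expInt (p q : ℝ) : Continuous (expInt p q) := by
  unfold expInt
  exact intervalIntegral.continuous_parametric_intervalIntegral_of_continuous' (by fun_prop) _ _

lemma expInt_symm (p q t : ℝ) : expInt q p t = -expInt p q t :=
  intervalIntegral.integral_symm _ _

lemma memLp_expInt {p q : ℝ} (hp : 0 < p) (hq : 0 < q) :
    MemLp (expInt p q) 2 (volume.restrict (Set.Ioi 0)) := by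
  wlog hpq : p ≤ q generalizing p q
  · convert! (this hq hp (le_of_not_ge hpq)).neg using 1
    ext t
    simp [expInt_symm q p]
  rw [memLp_two_iff_integrable_sq (continuous_expInt p q).aestronglyMeasurable]
  simp_rw [expInt_sq hpq]
  exact (integrable_exp_prod hp).integral_prod_left

lemma integral_inv_add {p q s : ℝ} (hp : 0 < p) (hpq : p ≤ q) (hs : 0 < s) :
    ∫ x in p..q, (s + x)⁻¹ = Real.log (s + q) - Real.log (s + p) := by
  rw [intervalIntegral.integral_comp_add_left (fun x => x⁻¹),
    integral_inv_of_pos (by positivity) (by linarith), Real.log_div (by linarith) (by positivity)]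

lemma integral_log_add_sub {p q : ℝ} (hp : 0 < p) (hpq : p ≤ q) :
    ∫ s in p..q, (Real.log (s + q) - Real.log (s + p)) = 2 * jsKernel p q := by
  have hq : 0 < q := hp.trans_le hpq
  have hlog : ∀ c : ℝ, IntervalIntegrable (fun s => Real.log (s + c)) volume p q := fun c => by
    have := (intervalIntegral.intervalIntegrable_log' (a := p + c) (b := q + c))
    simpa using this.comp_add_right c
  rw [intervalIntegral.integral_sub (hlog q) (hlog p),
    intervalIntegral.integral_comp_add_right Real.log,
    intervalIntegral.integral_comp_add_right Real.log, integral_log, integral_log, jsKernel,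
    Real.log_div hp.ne' (by positivity), Real.log_div hq.ne' (by positivity),
    Real.log_div (by positivity) two_ne_zero, ← two_mul, ← two_mul, add_comm q p,
    Real.log_mul two_ne_zero hp.ne', Real.log_mul two_ne_zero hq.ne']
  ring

/-- The Jensen–Shannon kernel as a squared `L²` distance. -/
lemma integral_expInt_sq {p q : ℝ} (hp : 0 < p) (hq : 0 < q) :
    ∫ t in Set.Ioi 0, expInt p q t ^ 2 = 2 * jsKernel p q := by
  wlog hpq : p ≤ q generalizing p q
  · rw [jsKernel_comm, ← this hq hp (le_of_not_ge hpq)]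
    simp [expInt_symm q p]
  have hsw := integral_integral_swap
    (f := fun (t : ℝ) (z : ℝ × ℝ) => Real.exp (-(t * (z.1 + z.2)))) (integrable_exp_prod (q := q) hp)
  have hint := (integrable_exp_prod (q := q) hp).integral_prod_right
  have hin : ∀ z ∈ Set.Ioc p q ×ˢ Set.Ioc p q,
      ∫ t in Set.Ioi 0, Real.exp (-(t * (z.1 + z.2))) = (z.1 + z.2)⁻¹ := by
    rintro z ⟨h1, h2⟩
    have hz : 0 < z.1 + z.2 := by linarith [h1.1, h2.1]
    have := integral_exp_mul_Ioi (a := -(z.1 + z.2)) (by linarith) 0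
    simp only [mul_zero, Real.exp_zero] at this
    rw [show (z.1 + z.2)⁻¹ = -1 / -(z.1 + z.2) by rw [neg_div_neg_eq, one_div], ← this]
    refine integral_congr_ae (.of_forall fun t => ?_)
    simp only
    ring_nf
  have hae : (fun z : ℝ × ℝ => ∫ t in Set.Ioi 0, Real.exp (-(t * (z.1 + z.2))))
      =ᵐ[(volume.restrict (Set.Ioc p q)).prod (volume.restrict (Set.Ioc p q))]
      fun z => (z.1 + z.2)⁻¹ := by
    rw [Measure.prod_restrict]
    filter_upwards [ae_restrict_mem (measurableSet_Ioc.prod measurableSet_Ioc)] with z hz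
    exact hin z hz
  simp_rw [expInt_sq hpq]
  rw [hsw, integral_congr_ae hae, integral_prod _ (hint.congr hae), ← integral_log_add_sub hp hpq,
    intervalIntegral.integral_of_le hpq]
  refine setIntegral_congr_fun measurableSet_Ioc fun s hs => ?_
  simp only
  rw [← integral_inv_add hp hpq (hp.trans hs.1), intervalIntegral.integral_of_le hpq]

lemma jsKernel_nonneg {p q : ℝ} (hp : 0 < p) (hq : 0 < q) : 0 ≤ jsKernel p q := by
  have : 0 ≤ ∫ t in Set.Ioi 0, expInt p q t ^ 2 := integral_nonneg fun _ => sq_nonneg _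
  rw [integral_expInt_sq hp hq] at this
  linarith

/-- The square root of the Jensen–Shannon kernel satisfies the triangle inequality. -/
lemma sqrt_jsKernel_triangle {p r q : ℝ} (hp : 0 < p) (hr : 0 < r) (hq : 0 < q) :
    Real.sqrt (jsKernel p q) ≤ Real.sqrt (jsKernel p r) + Real.sqrt (jsKernel r q) := by
  have h := sqrt_integral_add_sq_le (memLp_expInt hp hr) (memLp_expInt hr hq)
  simp_rw [expInt_add] at h
  rw [integral_expInt_sq hp hq, integral_expInt_sq hp hr, integral_expInt_sq hr hq,
    Real.sqrt_mul zero_le_two, Real.sqrt_mul zero_le_two, Real.sqrt_mul zero_le_two,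
    ← mul_add] at h
  exact le_of_mul_le_mul_left h (by positivity)

/-- The two-sided bound `e^{-c} p ≤ f ≤ e^c p` passes to integrability of the terms of
the Jensen–Shannon divergence. -/
lemma integrable_mul_log {S : Type*} [MeasurableSpace S] {ν : Measure S} {f g p : S → ℝ} {c : ℝ}
    (hf : Measurable f) (hg : Measurable g) (hp : Integrable p ν)
    (hp0 : ∀ᵐ d ∂ν, 0 < p d)
    (hfp : ∀ᵐ d ∂ν, f d ∈ Set.Icc (Real.exp (-c) * p d) (Real.exp c * p d))
    (hgp : ∀ᵐ d ∂ν, g d ∈ Set.Icc (Real.exp (-c) * p d) (Real.exp c * p d)) :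
    Integrable (fun d => f d * Real.log (f d / ((f d + g d) / 2))) ν := by
  refine (hp.const_mul (Real.exp c * (2 * c))).mono' (by fun_prop) ?_
  filter_upwards [hp0, hfp, hgp] with d h0 h1 h2
  have hlo : 0 < Real.exp (-c) * p d := by positivity
  have hf0 : 0 < f d := hlo.trans_le h1.1
  have hg0 : 0 < g d := hlo.trans_le h2.1
  have hm0 : 0 < (f d + g d) / 2 := by positivity
  have key : ∀ x y : ℝ, 0 < x → 0 < y → x ≤ Real.exp c * p d → Real.exp (-c) * p d ≤ y →
      Real.log x - Real.log y ≤ 2 * c := by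
    intro x y hx hy hx1 hy1
    have h3 := Real.log_le_log hx hx1
    have h4 := Real.log_le_log hlo hy1
    rw [Real.log_mul (Real.exp_ne_zero _) h0.ne', Real.log_exp] at h3 h4
    linarith
  rw [norm_mul, Real.norm_eq_abs, Real.norm_eq_abs, abs_of_pos hf0,
    Real.log_div hf0.ne' hm0.ne']
  have h5 : |Real.log (f d) - Real.log ((f d + g d) / 2)| ≤ 2 * c := by
    rw [abs_sub_le_iff]
    exact ⟨key _ _ hf0 hm0 h1.2 (by linarith [h1.1, h2.1]),
      key _ _ hm0 hf0 (by linarith [h1.2, h2.2]) h1.1⟩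
  calc _ ≤ Real.exp c * p d * (2 * c) := by gcongr; exact h1.2
    _ = _ := by ring

section Bounded

variable {S : Type*} [MeasurableSpace S] {ν : Measure S} {f g k p : S → ℝ} {c : ℝ}

lemma integrable_jsKernel (hf : Measurable f) (hg : Measurable g) (hp : Integrable p ν)
    (hp0 : ∀ᵐ d ∂ν, 0 < p d)
    (hfp : ∀ᵐ d ∂ν, f d ∈ Set.Icc (Real.exp (-c) * p d) (Real.exp c * p d))
    (hgp : ∀ᵐ d ∂ν, g d ∈ Set.Icc (Real.exp (-c) * p d) (Real.exp c * p d)) :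
    Integrable (fun d => jsKernel (f d) (g d)) ν := by
  refine (integrable_mul_log hf hg hp hp0 hfp hgp).add ?_
  simpa only [add_comm] using integrable_mul_log hg hf hp hp0 hgp hfp

lemma jsDiv_eq (hf : Measurable f) (hg : Measurable g) (hp : Integrable p ν)
    (hp0 : ∀ᵐ d ∂ν, 0 < p d)
    (hfp : ∀ᵐ d ∂ν, f d ∈ Set.Icc (Real.exp (-c) * p d) (Real.exp c * p d))
    (hgp : ∀ᵐ d ∂ν, g d ∈ Set.Icc (Real.exp (-c) * p d) (Real.exp c * p d)) :
    jsDiv ν f g = 1 / 2 * ∫ d, jsKernel (f d) (g d) ∂ν := by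
  have h2 := integrable_mul_log hg hf hp hp0 hgp hfp
  simp only [add_comm (g _)] at h2
  unfold jsDiv jsKernel
  rw [integral_add (integrable_mul_log hf hg hp hp0 hfp hgp) h2]
  ring

/-- The triangle inequality for the square root of the Jensen–Shannon divergence. -/
lemma sqrt_jsDiv_triangle (hf : Measurable f) (hg : Measurable g) (hk : Measurable k)
    (hp : Integrable p ν) (hp0 : ∀ᵐ d ∂ν, 0 < p d)
    (hfp : ∀ᵐ d ∂ν, f d ∈ Set.Icc (Real.exp (-c) * p d) (Real.exp c * p d))
    (hgp : ∀ᵐ d ∂ν, g d ∈ Set.Icc (Real.exp (-c) * p d) (Real.exp c * p d))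
    (hkp : ∀ᵐ d ∂ν, k d ∈ Set.Icc (Real.exp (-c) * p d) (Real.exp c * p d)) :
    Real.sqrt (jsDiv ν f k) ≤ Real.sqrt (jsDiv ν f g) + Real.sqrt (jsDiv ν g k) := by
  have pos : ∀ {u : S → ℝ}, (∀ᵐ d ∂ν, u d ∈ Set.Icc (Real.exp (-c) * p d) (Real.exp c * p d)) →
      ∀ᵐ d ∂ν, 0 < u d := by
    intro u hu
    filter_upwards [hp0, hu] with d h0 h1
    exact lt_of_lt_of_le (by positivity) h1.1
  have sq : ∀ {u v : S → ℝ}, (∀ᵐ d ∂ν, 0 < u d) → (∀ᵐ d ∂ν, 0 < v d) →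
      (fun d => Real.sqrt (jsKernel (u d) (v d)) ^ 2) =ᵐ[ν] fun d => jsKernel (u d) (v d) := by
    intro u v hu hv
    filter_upwards [hu, hv] with d h0 h1
    rw [Real.sq_sqrt (jsKernel_nonneg h0 h1)]
  have mem : ∀ {u v : S → ℝ}, Measurable u → Measurable v →
      (∀ᵐ d ∂ν, u d ∈ Set.Icc (Real.exp (-c) * p d) (Real.exp c * p d)) →
      (∀ᵐ d ∂ν, v d ∈ Set.Icc (Real.exp (-c) * p d) (Real.exp c * p d)) →
      MemLp (fun d => Real.sqrt (jsKernel (u d) (v d))) 2 ν := by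
    intro u v hu hv hup hvp
    rw [memLp_two_iff_integrable_sq (measurable_jsKernel hu hv).sqrt.aestronglyMeasurable]
    exact (integrable_jsKernel hu hv hp hp0 hup hvp).congr (sq (pos hup) (pos hvp)).symm
  have h := sqrt_integral_add_sq_le (mem hf hg hfp hgp) (mem hg hk hgp hkp)
  rw [integral_congr_ae (sq (pos hfp) (pos hgp)), integral_congr_ae (sq (pos hgp) (pos hkp))] at h
  have h' : ∫ d, jsKernel (f d) (k d) ∂ν
      ≤ ∫ d, (Real.sqrt (jsKernel (f d) (g d)) + Real.sqrt (jsKernel (g d) (k d))) ^ 2 ∂ν := by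
    refine integral_mono_ae (integrable_jsKernel hf hk hp hp0 hfp hkp)
      ((mem hf hg hfp hgp).add (mem hg hk hgp hkp)).integrable_sq ?_
    filter_upwards [pos hfp, pos hgp, pos hkp] with d h1 h2 h3
    exact (Real.sqrt_le_left (by positivity)).1 (sqrt_jsKernel_triangle h1 h2 h3)
  rw [jsDiv_eq hf hk hp hp0 hfp hkp, jsDiv_eq hf hg hp hp0 hfp hgp, jsDiv_eq hg hk hp hp0 hgp hkp,
    Real.sqrt_mul (by norm_num), Real.sqrt_mul (by norm_num), Real.sqrt_mul (by norm_num),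
    ← mul_add]
  gcongr
  exact (Real.sqrt_le_sqrt h').trans h

/-- A bound for the Jensen–Shannon divergence of two close densities. -/
lemma sqrt_jsDiv_le {δ : ℝ} (hδ : 0 ≤ δ) (hc : 0 ≤ c)
    (hf : Measurable f) (hg : Measurable g)
    (hp : Integrable p ν) (hp1 : ∫ d, p d ∂ν = 1) (hp0 : ∀ᵐ d ∂ν, 0 < p d)
    (hfp : ∀ᵐ d ∂ν, f d ∈ Set.Icc (Real.exp (-c) * p d) (Real.exp c * p d))
    (hgp : ∀ᵐ d ∂ν, g d ∈ Set.Icc (Real.exp (-c) * p d) (Real.exp c * p d))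
    (hfg : ∀ᵐ d ∂ν, |f d - g d| ≤ (Real.exp c - Real.exp (-c)) * p d * δ) :
    Real.sqrt (jsDiv ν f g) ≤ (Real.exp (2 * c) - 1) / 2 * δ := by
  have hE : 1 ≤ Real.exp c := Real.one_le_exp hc
  have hEE : Real.exp (-c) * Real.exp c = 1 := by rw [← Real.exp_add]; simp
  have hE2 : Real.exp (2 * c) = Real.exp c ^ 2 := by rw [← Real.exp_nat_mul]; simp
  set E := Real.exp c with hEdef
  set E' := Real.exp (-c) with hEdef'
  have hE'0 : 0 < E' := Real.exp_pos _
  rw [Real.sqrt_le_left (by rw [hE2]; have : 0 ≤ E ^ 2 - 1 := by nlinarith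
                            positivity),
    jsDiv_eq hf hg hp hp0 hfp hgp]
  have hle : ∫ d, jsKernel (f d) (g d) ∂ν ≤ ∫ d, (E - E') ^ 2 * δ ^ 2 * E / 2 * p d ∂ν := by
    refine integral_mono_ae (integrable_jsKernel hf hg hp hp0 hfp hgp) (hp.const_mul _) ?_
    filter_upwards [hp0, hfp, hgp, hfg] with d h0 h1 h2 h3
    have hlo : 0 < E' * p d := by positivity
    refine (jsKernel_le (hlo.trans_le h1.1) (hlo.trans_le h2.1)).trans ?_
    have h4 : (f d - g d) ^ 2 ≤ ((E - E') * p d * δ) ^ 2 := by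
      rw [← sq_abs]; gcongr
    calc (f d - g d) ^ 2 / (f d + g d) ≤ ((E - E') * p d * δ) ^ 2 / (E' * p d + E' * p d) := by
          gcongr
          exacts [h1.1, h2.1]
      _ = (E - E') ^ 2 * δ ^ 2 * (E' * E) / 2 / E' * p d := by
          rw [hEE]; field_simp; ring
      _ = _ := by field_simp
  rw [integral_const_mul, hp1, mul_one] at hle
  have hE'1 : E' ≤ 1 := by nlinarith
  calc 1 / 2 * ∫ d, jsKernel (f d) (g d) ∂ν ≤ 1 / 2 * ((E - E') ^ 2 * δ ^ 2 * E / 2) := by gcongr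
    _ = ((E ^ 2 - E' * E) / 2 * δ) ^ 2 * (E' * (E' * E)) := by
        have : (E - E') ^ 2 * E = (E ^ 2 - E' * E) ^ 2 * (E' * (E' * E)) := by
          have h1 : E ^ 2 - E' * E = E * (E - E') := by ring
          rw [h1]
          calc (E - E') ^ 2 * E = (E - E') ^ 2 * E * (E' * E) * (E' * E) := by rw [hEE]; ring
            _ = _ := by ring
        linear_combination (δ ^ 2 / 4) * this
    _ = ((E ^ 2 - 1) / 2 * δ) ^ 2 * E' := by rw [hEE, mul_one]
    _ ≤ ((Real.exp (2 * c) - 1) / 2 * δ) ^ 2 := by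
        rw [hE2]; exact mul_le_of_le_one_right (sq_nonneg _) hE'1

end Bounded

/-- The total variation bound by the `χ²`-divergence, in dual form. -/
lemma abs_integral_withDensity_sub_le {S : Type*} [MeasurableSpace S] {Q : Measure S}
    [IsProbabilityMeasure Q] {r g : S → ℝ} {a b δ : ℝ} (hδ : 0 ≤ δ) (hab : a ≤ b)
    (hr : Measurable r) (hr0 : ∀ x, 0 ≤ r x) (hr2 : MemLp r 2 Q) (hr1 : ∫ x, r x ∂Q = 1)
    (hχ : ∫ x, r x ^ 2 ∂Q ≤ 1 + δ ^ 2)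
    (hg : Measurable g) (hgab : ∀ x, g x ∈ Set.Icc a b) :
    |∫ x, g x ∂(Q.withDensity fun x => ENNReal.ofReal (r x)) - ∫ x, g x ∂Q|
      ≤ (b - a) / 2 * δ := by
  have hP : ∫ x, g x ∂(Q.withDensity fun x => ENNReal.ofReal (r x)) = ∫ x, r x * g x ∂Q := by
    rw [integral_withDensity_eq_integral_toReal_smul hr.ennreal_ofReal
      (.of_forall fun x => ENNReal.ofReal_lt_top)]
    simp [ENNReal.toReal_ofReal (hr0 _)]
  have hgb : ∀ x, ‖g x - (a + b) / 2‖ ≤ (b - a) / 2 := fun x => by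
    rw [Real.norm_eq_abs, abs_le]
    constructor <;> linarith [(hgab x).1, (hgab x).2]
  have hu : MemLp (fun x => g x - (a + b) / 2) 2 Q :=
    MemLp.of_bound (hg.sub_const _).aestronglyMeasurable ((b - a) / 2) (.of_forall hgb)
  have hg2 : MemLp g 2 Q := by
    convert! hu.add (memLp_const ((a + b) / 2)) using 1
    ext x
    simp
  have hw : MemLp (fun x => r x - 1) 2 Q := hr2.sub (memLp_const 1)
  have hrg : Integrable (fun x => r x * g x) Q := hr2.integrable_mul hg2
  have hri : Integrable r Q := hr2.integrable one_le_two
  have hgi : Integrable g Q := hg2.integrable one_le_two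
  have hexp : ∫ x, (g x - (a + b) / 2) * (r x - 1) ∂Q = ∫ x, r x * g x ∂Q - ∫ x, g x ∂Q := by
    have : ∀ x, (g x - (a + b) / 2) * (r x - 1)
        = (r x * g x - g x) - (a + b) / 2 * (r x - 1) := fun x => by ring
    simp_rw [this]
    have h1 : Integrable (fun x => r x * g x - g x) Q := hrg.sub hgi
    have h2 : Integrable (fun x => (a + b) / 2 * (r x - 1)) Q :=
      (hri.sub (integrable_const 1)).const_mul _
    rw [integral_sub h1 h2,
      integral_sub hrg hgi, integral_const_mul, integral_sub hri (integrable_const 1), hr1]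
    simp
  have hwint : ∫ x, (r x - 1) ^ 2 ∂Q ≤ δ ^ 2 := by
    have := integral_mul_add_sq hr2 (memLp_const (-1 : ℝ)) 1
    simp only [mul_one, ← sub_eq_add_neg, integral_mul_const, hr1] at this
    rw [this]
    simp
    linarith
  have huint : ∫ x, (g x - (a + b) / 2) ^ 2 ∂Q ≤ ((b - a) / 2) ^ 2 := by
    calc _ ≤ ∫ _, ((b - a) / 2) ^ 2 ∂Q := by
          refine integral_mono hu.integrable_sq (integrable_const _) fun x => ?_
          simp only
          rw [← sq_abs]
          exact pow_le_pow_left₀ (abs_nonneg _) (hgb x) 2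
      _ = _ := by simp
  rw [hP, ← hexp]
  refine abs_le_of_sq_le_sq ?_ (mul_nonneg (by linarith) hδ)
  calc _ ≤ _ := sq_integral_mul_le hu hw
    _ ≤ ((b - a) / 2) ^ 2 * δ ^ 2 :=
        mul_le_mul huint hwint (integral_nonneg fun _ => sq_nonneg _) (sq_nonneg _)
    _ = _ := by ring

/-- The likelihood ratio of two Gaussian distributions on the line. -/
def gaussianRatio (m : ℝ) (v u : NNReal) (x : ℝ) : ℝ :=
  gaussianPDFReal m v x / gaussianPDFReal m u x

lemma measurable_gaussianRatio (m : ℝ) (v u : NNReal) : Measurable (gaussianRatio m v u) :=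
  (measurable_gaussianPDFReal m v).div (measurable_gaussianPDFReal m u)

lemma gaussianRatio_nonneg (m : ℝ) (v u : NNReal) (x : ℝ) : 0 ≤ gaussianRatio m v u x :=
  div_nonneg (gaussianPDFReal_nonneg _ _ _) (gaussianPDFReal_nonneg _ _ _)

lemma gaussianReal_eq_withDensity_ratio (m : ℝ) {v u : NNReal} (hv : v ≠ 0) (hu : u ≠ 0) :
    gaussianReal m v
      = (gaussianReal m u).withDensity fun x => ENNReal.ofReal (gaussianRatio m v u x) := by
  rw [gaussianReal_of_var_ne_zero _ hv, gaussianReal_of_var_ne_zero _ hu,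
    ← withDensity_mul _ (measurable_gaussianPDF m u)
      (measurable_gaussianRatio m v u).ennreal_ofReal]
  congr 1
  ext x
  have := gaussianPDFReal_pos m u x hu
  simp only [Pi.mul_apply, gaussianPDF, gaussianRatio]
  rw [← ENNReal.ofReal_mul this.le, mul_div_cancel₀ _ this.ne']

lemma gaussianPDF_mul_ratio_sq (m : ℝ) {v u : NNReal} (hv : 0 < v) (hu : 0 < u) (x : ℝ) :
    gaussianPDFReal m u x * gaussianRatio m v u x ^ 2
      = Real.sqrt (2 * Real.pi * u) / (2 * Real.pi * v)
        * Real.exp (-((2 * u - v) / (2 * u * v)) * (x - m) ^ 2) := by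
  have hv' : (0 : ℝ) < v := hv
  have hu' : (0 : ℝ) < u := hu
  have hs : Real.sqrt (2 * Real.pi * v) ^ 2 = 2 * Real.pi * v := Real.sq_sqrt (by positivity)
  have hsv : 0 < Real.sqrt (2 * Real.pi * v) := by positivity
  have hsu : 0 < Real.sqrt (2 * Real.pi * u) := by positivity
  have h1 : gaussianPDFReal m u x * gaussianRatio m v u x ^ 2
      = gaussianPDFReal m v x ^ 2 / gaussianPDFReal m u x := by
    have := gaussianPDFReal_pos m u x hu.ne'
    rw [gaussianRatio]
    field_simp
  rw [h1, gaussianPDFReal, gaussianPDFReal, mul_pow, inv_pow, hs, ← Real.exp_nat_mul,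
    show -((2 * (u : ℝ) - v) / (2 * u * v)) * (x - m) ^ 2
      = (2 : ℕ) * (-(x - m) ^ 2 / (2 * v)) - -(x - m) ^ 2 / (2 * u) by push_cast; field_simp; ring,
    Real.exp_sub]
  field_simp

lemma memLp_gaussianRatio (m : ℝ) {v u : NNReal} (hv : 0 < v) (hvu : v ≤ u) :
    MemLp (gaussianRatio m v u) 2 (gaussianReal m u) := by
  have hu : 0 < u := hv.trans_le hvu
  have hv' : (0 : ℝ) < v := hv
  have hu' : (0 : ℝ) < u := hu
  have hvu' : (v : ℝ) ≤ u := hvu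
  rw [memLp_two_iff_integrable_sq (measurable_gaussianRatio m v u).aestronglyMeasurable,
    gaussianReal_of_var_ne_zero _ hu.ne',
    integrable_withDensity_iff_integrable_smul' (measurable_gaussianPDF m u)
      (.of_forall fun x => gaussianPDF_lt_top)]
  simp only [toReal_gaussianPDF, smul_eq_mul, gaussianPDF_mul_ratio_sq m hv hu]
  refine Integrable.const_mul ?_ _
  exact (integrable_exp_neg_mul_sq (b := (2 * u - v) / (2 * u * v))
    (div_pos (by linarith) (by positivity))).comp_sub_right m

lemma integral_gaussianRatio_sq_le (m : ℝ) {v u : NNReal} (hv : 0 < v) (hvu : v ≤ u) :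
    ∫ x, gaussianRatio m v u x ^ 2 ∂(gaussianReal m u)
      ≤ Real.exp ((((u : ℝ) - v) / v) ^ 2 / 2) := by
  have hu : 0 < u := hv.trans_le hvu
  have hv' : (0 : ℝ) < v := hv
  have hu' : (0 : ℝ) < u := hu
  have hvu' : (v : ℝ) ≤ u := hvu
  have huv : (0 : ℝ) < 2 * u - v := by linarith
  rw [integral_gaussianReal_eq_integral_smul hu.ne']
  simp only [smul_eq_mul, gaussianPDF_mul_ratio_sq m hv hu]
  rw [integral_const_mul, integral_sub_right_eq_self
    (fun x => Real.exp (-((2 * (u : ℝ) - v) / (2 * u * v)) * x ^ 2)) m, integral_gaussian]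
  refine le_of_sq_le_sq ?_ (Real.exp_pos _).le
  rw [mul_pow, div_pow, Real.sq_sqrt (by positivity), Real.sq_sqrt (by positivity),
    ← Real.exp_nat_mul]
  have h1 := Real.add_one_le_exp ((((u : ℝ) - v) / v) ^ 2)
  calc 2 * Real.pi * u / (2 * Real.pi * v) ^ 2 * (Real.pi / ((2 * u - v) / (2 * u * v)))
      = 1 + ((u : ℝ) - v) ^ 2 / (v * (2 * u - v)) := by field_simp; ring
    _ ≤ 1 + ((u : ℝ) - v) ^ 2 / (v * v) := by gcongr; linarith
    _ = (((u : ℝ) - v) / v) ^ 2 + 1 := by field_simp; ring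
    _ ≤ _ := h1
    _ = _ := by congr 1; push_cast; ring

lemma integral_gaussianRatio (m : ℝ) {v u : NNReal} (hv : 0 < v) (hu : 0 < u) :
    ∫ x, gaussianRatio m v u x ∂(gaussianReal m u) = 1 := by
  rw [integral_gaussianReal_eq_integral_smul hu.ne', ← integral_gaussianPDFReal_eq_one m hv.ne']
  refine integral_congr_ae (.of_forall fun x => ?_)
  simp only [gaussianRatio, smul_eq_mul]
  rw [mul_div_cancel₀ _ (gaussianPDFReal_pos m u x hu.ne').ne']

/-- A product of measures with densities has the product density. -/
lemma pi_withDensity_ofReal {ι : Type*} [Fintype ι] {S : ι → Type*} [∀ i, MeasurableSpace (S i)]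
    {q : ∀ i, Measure (S i)} [∀ i, IsProbabilityMeasure (q i)] {r : ∀ i, S i → ℝ}
    [∀ i, SigmaFinite ((q i).withDensity fun x => ENNReal.ofReal (r i x))]
    (hr0 : ∀ i x, 0 ≤ r i x) (hri : ∀ i, Integrable (r i) (q i)) :
    Measure.pi (fun i => (q i).withDensity fun x => ENNReal.ofReal (r i x))
      = (Measure.pi q).withDensity fun x => ENNReal.ofReal (∏ i, r i (x i)) := by
  refine Measure.pi_eq fun s hs => ?_
  have hpi : ∀ x : ∀ i, S i, (Set.univ.pi s).indicator (fun x => ∏ i, r i (x i)) x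
      = ∏ i, (s i).indicator (r i) (x i) := by
    intro x
    by_cases hx : x ∈ Set.univ.pi s
    · rw [Set.indicator_of_mem hx]
      exact Finset.prod_congr rfl fun i _ => (Set.indicator_of_mem (hx i trivial) _).symm
    · rw [Set.indicator_of_notMem hx]
      obtain ⟨i, hi⟩ : ∃ i, x i ∉ s i := by simpa using hx
      exact (Finset.prod_eq_zero (Finset.mem_univ i) (Set.indicator_of_notMem hi _)).symm
  have hS : MeasurableSet (Set.univ.pi s) := MeasurableSet.univ_pi hs
  rw [withDensity_apply _ hS, ← ofReal_integral_eq_lintegral_ofReal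
      (Integrable.fintype_prod_dep hri).integrableOn
      (.of_forall fun x => Finset.prod_nonneg fun i _ => hr0 i _),
    ← integral_indicator hS]
  simp_rw [hpi]
  rw [integral_fintype_prod_eq_prod, ENNReal.ofReal_prod_of_nonneg
    fun i _ => integral_nonneg fun x => Set.indicator_nonneg (fun x _ => hr0 i x) x]
  refine Finset.prod_congr rfl fun i _ => ?_
  rw [withDensity_apply _ (hs i), integral_indicator (hs i),
    ofReal_integral_eq_lintegral_ofReal (hri i).integrableOn (.of_forall (hr0 i))]

section Gaussian

variable {n : ℕ}

lemma charFun_multivariateGaussian_diagonal (μ : Param n) {v : Fin n → ℝ} (hv : ∀ i, 0 ≤ v i)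
    (x : Param n) :
    charFun (multivariateGaussian μ (Matrix.diagonal v)) x
      = Complex.exp (∑ i, ((x i : ℂ) * μ i * Complex.I - v i * (x i : ℂ) ^ 2 / 2)) := by
  rw [charFun_multivariateGaussian (Matrix.PosSemidef.diagonal hv)]
  congr 1
  simp only [PiLp.inner_apply, Matrix.mulVec_diagonal, dotProduct, Finset.sum_sub_distrib,
    ← Finset.sum_mul, ← Finset.sum_div]
  simp
  congr 1
  · simp_rw [mul_comm]
  · congr 1
    exact Finset.sum_congr rfl fun i _ => by ring

lemma multivariateGaussian_diagonal_eq_pi (μ : Param n) (v : Fin n → NNReal) :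
    multivariateGaussian μ (Matrix.diagonal fun i => (v i : ℝ))
      = (Measure.pi fun i => gaussianReal (μ i) (v i)).map (WithLp.toLp 2) := by
  have : IsProbabilityMeasure
      ((Measure.pi fun i => gaussianReal (μ i) (v i)).map (WithLp.toLp 2)) :=
    Measure.isProbabilityMeasure_map (by fun_prop)
  refine Measure.ext_of_charFun (E := Param n) (funext fun x => ?_)
  rw [charFun_multivariateGaussian_diagonal μ fun i => (v i).coe_nonneg]
  simp_rw [charFun_pi, charFun_gaussianReal, ← Complex.exp_sum]

/-- Comparison of the expectations of a bounded function under two Gaussian distributions with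
the same mean and diagonal covariance matrices. -/
lemma abs_integral_gaussian_sub_le (μ : Param n) {v u : Fin n → ℝ} (hv : ∀ i, 0 < v i)
    (hvu : ∀ i, v i ≤ u i) (hsmall : ∑ i, ((u i - v i) / v i) ^ 2 ≤ 1)
    {g : Param n → ℝ} {a b : ℝ} (hab : a ≤ b) (hg : Measurable g)
    (hgab : ∀ x, g x ∈ Set.Icc a b) :
    |∫ x, g x ∂(multivariateGaussian μ (Matrix.diagonal v))
        - ∫ x, g x ∂(multivariateGaussian μ (Matrix.diagonal u))|
      ≤ (b - a) / 2 * Real.sqrt (∑ i, ((u i - v i) / v i) ^ 2) := by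
  lift v to Fin n → NNReal using fun i => (hv i).le
  lift u to Fin n → NNReal using fun i => (hv i).le.trans (hvu i)
  have hv' : ∀ i, 0 < v i := hv
  have hvu' : ∀ i, v i ≤ u i := hvu
  have hu' : ∀ i, 0 < u i := fun i => (hv' i).trans_le (hvu' i)
  set L := ∑ i, (((u i : ℝ) - v i) / v i) ^ 2 with hL
  have hL0 : 0 ≤ L := Finset.sum_nonneg fun i _ => sq_nonneg _
  have hd : (Measure.pi fun i => gaussianReal (μ i) (v i))
      = (Measure.pi fun i => gaussianReal (μ i) (u i)).withDensity
        fun x => ENNReal.ofReal (∏ i, gaussianRatio (μ i) (v i) (u i) (x i)) := by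
    have h1 := fun i => gaussianReal_eq_withDensity_ratio (μ i) (hv' i).ne' (hu' i).ne'
    have : ∀ i, SigmaFinite ((gaussianReal (μ i) (u i)).withDensity
        fun x => ENNReal.ofReal (gaussianRatio (μ i) (v i) (u i) x)) := fun i => by
      rw [← h1]; infer_instance
    rw [← pi_withDensity_ofReal (fun i => gaussianRatio_nonneg _ _ _)
      fun i => (memLp_gaussianRatio (μ i) (hv' i) (hvu' i)).integrable one_le_two]
    simp_rw [← h1]
  have hmeas : Measurable fun x : Fin n → ℝ => ∏ i, gaussianRatio (μ i) (v i) (u i) (x i) :=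
    Finset.measurable_fun_prod _ fun i _ =>
      (measurable_gaussianRatio _ _ _).comp (measurable_pi_apply i)
  rw [multivariateGaussian_diagonal_eq_pi, multivariateGaussian_diagonal_eq_pi,
    integral_map (by fun_prop) hg.aestronglyMeasurable,
    integral_map (by fun_prop) hg.aestronglyMeasurable, hd]
  refine abs_integral_withDensity_sub_le (Real.sqrt_nonneg _) hab hmeas
    (fun x => Finset.prod_nonneg fun i _ => gaussianRatio_nonneg _ _ _ _) ?_ ?_ ?_
    (hg.comp (by fun_prop)) fun x => hgab _
  · rw [memLp_two_iff_integrable_sq hmeas.aestronglyMeasurable]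
    simp_rw [← Finset.prod_pow]
    exact Integrable.fintype_prod_dep
      fun i => (memLp_gaussianRatio (μ i) (hv' i) (hvu' i)).integrable_sq
  · rw [integral_fintype_prod_eq_prod]
    exact Finset.prod_eq_one fun i _ => integral_gaussianRatio _ (hv' i) (hu' i)
  · simp_rw [← Finset.prod_pow]
    rw [integral_fintype_prod_eq_prod (f := fun i x => gaussianRatio (μ i) (v i) (u i) x ^ 2),
      Real.sq_sqrt hL0]
    calc _ ≤ ∏ i, Real.exp ((((u i : ℝ) - v i) / v i) ^ 2 / 2) :=
          Finset.prod_le_prod (fun i _ => integral_nonneg fun _ => sq_nonneg _)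
            fun i _ => integral_gaussianRatio_sq_le _ (hv' i) (hvu' i)
      _ = Real.exp (L / 2) := by rw [← Real.exp_sum, ← Finset.sum_div]
      _ ≤ 1 + L := by
          have h := Real.abs_exp_sub_one_sub_id_le (x := L / 2) (by
            rw [abs_of_nonneg (by positivity)]; linarith)
          nlinarith [(abs_le.1 h).2]

variable {Ω : Type*} [MeasurableSpace Ω] {Pr : Measure Ω} [IsProbabilityMeasure Pr]

lemma hasLaw_add_gaussian {X Y : Ω → Param n} {μ₁ μ₂ : Param n} {v₁ v₂ : Fin n → ℝ}
    (hv₁ : ∀ i, 0 ≤ v₁ i) (hv₂ : ∀ i, 0 ≤ v₂ i)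
    (hX : HasLaw X (multivariateGaussian μ₁ (Matrix.diagonal v₁)) Pr)
    (hY : HasLaw Y (multivariateGaussian μ₂ (Matrix.diagonal v₂)) Pr)
    (h : IndepFun X Y Pr) :
    HasLaw (fun ω => X ω + Y ω)
      (multivariateGaussian (μ₁ + μ₂) (Matrix.diagonal fun i => v₁ i + v₂ i)) Pr where
  aemeasurable := hX.aemeasurable.add hY.aemeasurable
  map_eq := by
    have hXY : AEMeasurable (X + Y) Pr := hX.aemeasurable.add hY.aemeasurable
    have : IsProbabilityMeasure (Pr.map (X + Y)) := Measure.isProbabilityMeasure_map hXY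
    change Pr.map (X + Y) = _
    refine Measure.ext_of_charFun (funext fun x => ?_)
    rw [h.charFun_map_add_eq_mul hX.aemeasurable hY.aemeasurable, Pi.mul_apply, hX.map_eq,
      hY.map_eq, charFun_multivariateGaussian_diagonal _ hv₁,
      charFun_multivariateGaussian_diagonal _ hv₂,
      charFun_multivariateGaussian_diagonal _ fun i => add_nonneg (hv₁ i) (hv₂ i),
      ← Complex.exp_add, ← Finset.sum_add_distrib]
    congr 1
    refine Finset.sum_congr rfl fun i _ => ?_
    simp only [PiLp.add_apply]
    push_cast
    ring

lemma hasLaw_smul_sum_gaussian {ι : Type*} [Fintype ι] {X : ι → Ω → Param n} {m : ι → Param n}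
    {v : ι → Fin n → ℝ} (hv : ∀ k i, 0 ≤ v k i)
    (hX : ∀ k, HasLaw (X k) (multivariateGaussian (m k) (Matrix.diagonal (v k))) Pr)
    (h : iIndepFun X Pr) (c : ℝ) :
    HasLaw (fun ω => c • ∑ k, X k ω)
      (multivariateGaussian (c • ∑ k, m k) (Matrix.diagonal fun i => c ^ 2 * ∑ k, v k i)) Pr where
  aemeasurable := (Finset.aemeasurable_fun_sum _ fun k _ => (hX k).aemeasurable).const_smul c
  map_eq := by
    have hs : AEMeasurable (fun ω => ∑ k, X k ω) Pr :=
      Finset.aemeasurable_fun_sum _ fun k _ => (hX k).aemeasurable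
    have : IsProbabilityMeasure (Pr.map fun ω => c • ∑ k, X k ω) :=
      Measure.isProbabilityMeasure_map (hs.const_smul c)
    refine Measure.ext_of_charFun (funext fun x => ?_)
    rw [charFun_map_smul_comp hs,
      h.charFun_map_fun_sum_eq_prod fun k => (hX k).aemeasurable, Finset.prod_apply,
      charFun_multivariateGaussian_diagonal _
        fun i => mul_nonneg (sq_nonneg c) (Finset.sum_nonneg fun k _ => hv k i)]
    simp_rw [(hX _).map_eq, charFun_multivariateGaussian_diagonal _ (hv _), ← Complex.exp_sum]
    rw [Finset.sum_comm]
    congr 1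
    refine Finset.sum_congr rfl fun i _ => ?_
    simp only [PiLp.smul_apply, WithLp.ofLp_sum, Finset.sum_apply, smul_eq_mul,
      Finset.sum_sub_distrib, ← Finset.sum_mul, ← Finset.sum_div, ← Finset.mul_sum]
    push_cast
    ring

end Gaussian

section NoiseLevel

variable {n : ℕ}

lemma noiseLevel_nonneg (σ : Fin n → ℝ) (s : ℝ) : 0 ≤ noiseLevel σ s :=
  mul_nonneg (sq_nonneg s) (Real.sqrt_nonneg _)

lemma noiseLevel_eq_sqrt (σ : Fin n → ℝ) (s : ℝ) :
    noiseLevel σ s = Real.sqrt (∑ i, (s ^ 2 / σ i ^ 2) ^ 2) := by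
  have : ∀ i, (s ^ 2 / σ i ^ 2) ^ 2 = (s ^ 2) ^ 2 * (1 / σ i ^ 4) := fun i => by ring
  simp_rw [this]
  rw [← Finset.mul_sum, Real.sqrt_mul (by positivity), Real.sqrt_sq (by positivity), noiseLevel]

lemma monotoneOn_noiseLevel (σ : Fin n → ℝ) : MonotoneOn (noiseLevel σ) (Set.Ici 0) := by
  intro s hs t _ hst
  have : (0 : ℝ) ≤ s := hs
  unfold noiseLevel
  gcongr

lemma strictMonoOn_noiseLevel (hn : 0 < n) {σ : Fin n → ℝ} (hσ : ∀ i, 0 < σ i) :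
    StrictMonoOn (noiseLevel σ) (Set.Ici 0) := by
  intro s hs t _ hst
  have hs0 : (0 : ℝ) ≤ s := hs
  have : Nonempty (Fin n) := ⟨⟨0, hn⟩⟩
  have hpos : 0 < Real.sqrt (∑ i, 1 / σ i ^ 4) :=
    Real.sqrt_pos.2 (Finset.sum_pos (fun i _ => by have := hσ i; positivity)
      Finset.univ_nonempty)
  unfold noiseLevel
  gcongr

lemma abs_integral_sub_le_noiseLevel (μ : Param n) {σ : Fin n → ℝ} (hσ : ∀ i, 0 < σ i) {s c : ℝ}
    (hc : 0 < c) (hsmall : noiseLevel σ s ≤ 1) {g : Param n → ℝ} {a b : ℝ} (hab : a ≤ b)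
    (hg : Measurable g) (hgab : ∀ x, g x ∈ Set.Icc a b) :
    |∫ x, g x ∂(multivariateGaussian μ (Matrix.diagonal fun i => c * σ i ^ 2))
        - ∫ x, g x ∂(multivariateGaussian μ (Matrix.diagonal fun i => c * (σ i ^ 2 + s ^ 2)))|
      ≤ (b - a) / 2 * noiseLevel σ s := by
  have heq : ∀ i, (c * (σ i ^ 2 + s ^ 2) - c * σ i ^ 2) / (c * σ i ^ 2) = s ^ 2 / σ i ^ 2 :=
    fun i => by have := hσ i; field_simp; ring
  have h := abs_integral_gaussian_sub_le μ (v := fun i => c * σ i ^ 2)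
    (u := fun i => c * (σ i ^ 2 + s ^ 2)) (fun i => by have := hσ i; positivity)
    (fun i => by gcongr; linarith [sq_nonneg s]) ?_ hab hg hgab
  · simpa only [heq, ← noiseLevel_eq_sqrt] using h
  · simp only [heq]
    rw [noiseLevel_eq_sqrt] at hsmall
    exact (Real.sqrt_le_left zero_le_one).1 hsmall |>.trans_eq (one_pow 2)

end NoiseLevel

section Leakage

variable {n K : ℕ} {X : Type*} [MeasurableSpace X]

lemma Adversary.xi_nonneg (a : Adversary n X) : 0 ≤ a.xi := by
  refine Real.sSup_nonneg ?_
  rintro _ ⟨w, d, _, rfl⟩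
  exact abs_nonneg _

lemma xi_le_maxXi (A : Fin K → Adversary n X) (k : Fin K) : (A k).xi ≤ maxXi A :=
  le_ciSup (Set.finite_range fun k => (A k).xi).bddAbove k

lemma maxXi_nonneg (A : Fin K → Adversary n X) : 0 ≤ maxXi A :=
  Real.iSup_nonneg fun k => (A k).xi_nonneg

lemma constC3_nonneg (A : Fin K → Adversary n X) : 0 ≤ constC3 A := by
  have := Real.one_le_exp (mul_nonneg zero_le_two (maxXi_nonneg A))
  unfold constC3
  linarith

lemma constC3_pos {A : Fin K → Adversary n X} (h : 0 < maxXi A) : 0 < constC3 A := by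
  have := Real.one_lt_exp_iff.2 (mul_pos zero_lt_two h)
  unfold constC3
  linarith

namespace Adversary

variable {a : Adversary n X} {c : ℝ}

lemma posterior_mem (ha : a.FiniteXi) (hc : a.xi ≤ c) (w : Param n) {d : Dataset X}
    (hd : d ∈ a.carrier) :
    a.posterior w d ∈ Set.Icc (Real.exp (-c) * a.prior d) (Real.exp c * a.prior d) := by
  have hp := a.prior_pos d hd
  have hq := ha.1 w d hd
  have h : |Real.log (a.posterior w d / a.prior d)| ≤ c :=
    (le_csSup ha.2 ⟨w, d, hd, rfl⟩).trans hc
  rw [abs_le, Real.le_log_iff_exp_le (by positivity), Real.log_le_iff_le_exp (by positivity),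
    le_div_iff₀ hp, div_le_iff₀ hp] at h
  exact h

lemma measurable_belief (a : Adversary n X) (P : Measure (Param n)) [IsProbabilityMeasure P] :
    Measurable (a.belief P) :=
  (a.measurable_posterior.stronglyMeasurable.integral_prod_left' (μ := P)).measurable

lemma measurable_posterior_left (a : Adversary n X) (d : Dataset X) :
    Measurable fun w => a.posterior w d :=
  a.measurable_posterior.comp (measurable_id.prodMk measurable_const)

lemma belief_mem (ha : a.FiniteXi) (hc : a.xi ≤ c) (P : Measure (Param n))
    [IsProbabilityMeasure P] {d : Dataset X} (hd : d ∈ a.carrier) :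
    a.belief P d ∈ Set.Icc (Real.exp (-c) * a.prior d) (Real.exp c * a.prior d) := by
  have hmem := fun w => posterior_mem ha hc w hd
  have hint : Integrable (fun w => a.posterior w d) P := by
    refine Integrable.of_bound (a.measurable_posterior_left d).aestronglyMeasurable
      (Real.exp c * a.prior d) (.of_forall fun w => ?_)
    rw [Real.norm_of_nonneg (ha.1 w d hd).le]
    exact (hmem w).2
  constructor
  · simpa [belief] using integral_mono (integrable_const _) hint fun w => (hmem w).1
  · simpa [belief] using integral_mono hint (integrable_const _) fun w => (hmem w).2

/-- If bounded functions have close expectations under `P` and `P'`, then the leakages of `P`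
and `P'` are close. -/
lemma leakage_le (ha : a.FiniteXi) (hc : a.xi ≤ c) (P P' : Measure (Param n))
    [IsProbabilityMeasure P] [IsProbabilityMeasure P'] {δ : ℝ} (hδ : 0 ≤ δ)
    (h : ∀ (g : Param n → ℝ) (x y : ℝ), x ≤ y → Measurable g → (∀ w, g w ∈ Set.Icc x y) →
      |∫ w, g w ∂P - ∫ w, g w ∂P'| ≤ (y - x) / 2 * δ) :
    a.leakage P ≤ a.leakage P' + (Real.exp (2 * c) - 1) / 2 * δ := by
  have hc0 : 0 ≤ c := a.xi_nonneg.trans hc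
  have hE : Real.exp (-c) ≤ Real.exp c := Real.exp_le_exp.2 (by linarith)
  have hae : ∀ {q : Dataset X → Prop}, (∀ d ∈ a.carrier, q d) →
      ∀ᵐ d ∂a.ref.restrict a.carrier, q d := fun hq =>
    (ae_restrict_mem a.measurableSet_carrier).mono hq
  have hpint : Integrable a.prior (a.ref.restrict a.carrier) :=
    Integrable.of_integral_ne_zero (by rw [a.integral_prior]; exact one_ne_zero)
  have hp0 := hae a.prior_pos
  have hP := hae fun d hd => belief_mem ha hc P hd
  have hP' := hae fun d hd => belief_mem ha hc P' hd
  have hprior := hae (q := fun d => a.prior d ∈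
      Set.Icc (Real.exp (-c) * a.prior d) (Real.exp c * a.prior d)) fun d hd =>
    ⟨mul_le_of_le_one_left (a.prior_pos d hd).le (Real.exp_le_one_iff.2 (by linarith)),
      le_mul_of_one_le_left (a.prior_pos d hd).le (Real.one_le_exp hc0)⟩
  have htri := sqrt_jsDiv_triangle (a.measurable_belief P) (a.measurable_belief P')
    a.measurable_prior hpint hp0 hP hP' hprior
  have hle := sqrt_jsDiv_le hδ hc0 (a.measurable_belief P) (a.measurable_belief P') hpint
    a.integral_prior hp0 hP hP' (hae fun d hd => ?_)
  · unfold leakage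
    linarith
  · have hp := a.prior_pos d hd
    refine (h _ _ _ (mul_le_mul_of_nonneg_right hE hp.le) (a.measurable_posterior_left d)
      fun w => posterior_mem ha hc w hd).trans ?_
    have h0 : 0 ≤ (Real.exp c - Real.exp (-c)) * a.prior d * δ :=
      mul_nonneg (mul_nonneg (by linarith) hp.le) hδ
    linarith

end Adversary

lemma dataAverage_mem {Y : Type*} {g : Y → ℝ} {C : ℝ} (hg : ∀ x, g x ∈ Set.Icc 0 C)
    (D : Dataset Y) :
    dataAverage g D ∈ Set.Icc 0 C := by
  have hpos : (0 : ℝ) < (D.1 : ℝ) + 1 := by positivity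
  refine ⟨mul_nonneg (by positivity) (Finset.sum_nonneg fun j _ => (hg _).1), ?_⟩
  rw [dataAverage, inv_mul_le_iff₀ hpos]
  calc ∑ j, g (D.2 j) ≤ ∑ _j : Fin (D.1 + 1), C := Finset.sum_le_sum fun j _ => (hg _).2
    _ = _ := by simp

lemma measurable_dataAverage_left {U : Param n → X → ℝ} (hU : Measurable (Function.uncurry U))
    (D : Dataset X) : Measurable fun w => dataAverage (U w) D :=
  (Finset.measurable_fun_sum _ fun _ _ =>
    hU.comp (measurable_id.prodMk measurable_const)).const_mul _

lemma measurable_of_sigma {ι β : Type*} {S : ι → Type*} [∀ i, MeasurableSpace (S i)]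
    [MeasurableSpace β] {f : (Σ i, S i) → β} (h : ∀ i, Measurable fun x => f ⟨i, x⟩) :
    Measurable f := by
  intro t ht
  exact MeasurableSpace.measurableSet_iInf.2 fun i => h i ht

lemma measurable_integral_dataAverage {U : Param n → X → ℝ}
    (hU : Measurable (Function.uncurry U)) (P : Measure (Param n)) [IsProbabilityMeasure P] :
    Measurable fun D : Dataset X => ∫ w, dataAverage (U w) D ∂P := by
  refine measurable_of_sigma fun m => ?_
  have : Measurable fun z : Param n × (Fin (m + 1) → X) =>
      ((m : ℝ) + 1)⁻¹ * ∑ j, U z.1 (z.2 j) :=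
    (Finset.measurable_fun_sum _ fun j _ =>
      hU.comp (measurable_fst.prodMk ((measurable_pi_apply j).comp measurable_snd))).const_mul _
  exact (this.stronglyMeasurable.integral_prod_left' (μ := P)).measurable

lemma integrable_integral_dataAverage {U : Param n → X → ℝ}
    (hU : Measurable (Function.uncurry U)) {C : ℝ} (hC : ∀ w x, U w x ∈ Set.Icc 0 C)
    (P : Measure (Param n)) [IsProbabilityMeasure P] (Q : Measure (Dataset X))
    [IsProbabilityMeasure Q] :
    Integrable (fun D : Dataset X => ∫ w, dataAverage (U w) D ∂P) Q := by
  refine Integrable.of_bound (measurable_integral_dataAverage hU P).aestronglyMeasurable C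
    (.of_forall fun D => ?_)
  refine (norm_integral_le_of_norm_le_const (C := C) (.of_forall fun w => ?_)).trans (by simp)
  have := dataAverage_mem (hC w) D
  rw [Real.norm_of_nonneg this.1]
  exact this.2

lemma expectedUtility_sub_le {U : Param n → X → ℝ} (hU : Measurable (Function.uncurry U))
    {C : ℝ} (hC0 : 0 ≤ C) (hC : ∀ w x, U w x ∈ Set.Icc 0 C) (P P' : Measure (Param n))
    [IsProbabilityMeasure P] [IsProbabilityMeasure P'] (Q : Measure (Dataset X))
    [IsProbabilityMeasure Q] {δ : ℝ} (hδ : 0 ≤ δ)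
    (h : ∀ (g : Param n → ℝ) (x y : ℝ), x ≤ y → Measurable g → (∀ w, g w ∈ Set.Icc x y) →
      |∫ w, g w ∂P - ∫ w, g w ∂P'| ≤ (y - x) / 2 * δ) :
    expectedUtility U Q P - expectedUtility U Q P' ≤ C * δ := by
  have hi := integrable_integral_dataAverage hU hC P Q
  have hi' := integrable_integral_dataAverage hU hC P' Q
  unfold expectedUtility
  rw [← integral_sub hi hi']
  calc _ ≤ ∫ _, C * δ ∂Q := integral_mono (hi.sub hi') (integrable_const _) fun D => by
        have := (abs_le.1 (h _ 0 C hC0 (measurable_dataAverage_left hU D)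
          fun w => dataAverage_mem (hC w) D)).2
        have h0 := mul_nonneg hC0 hδ
        simp only [Pi.sub_apply]
        linarith
    _ = _ := by simp

lemma inv_mul_sum_le {K : ℕ} (hK : 0 < K) {f : Fin K → ℝ} {c : ℝ} (hf : ∀ k, f k ≤ c) :
    (K : ℝ)⁻¹ * ∑ k, f k ≤ c := by
  have hK' : (0 : ℝ) < K := Nat.cast_pos.2 hK
  rw [inv_mul_le_iff₀ hK']
  calc ∑ k, f k ≤ ∑ _k : Fin K, c := Finset.sum_le_sum fun k _ => hf k
    _ = _ := by simp

end Leakage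

end PrivacyUtility

end

theorem mainTheorem6
    {Ω X : Type*} [MeasurableSpace Ω] [MeasurableSpace X]
    (Pr : Measure Ω) [IsProbabilityMeasure Pr]
    {n K : ℕ} (hn : 0 < n) (hK : 0 < K)
    -- unprotected parameters `W_k ∼ N(μ₀, diag(σᵢ²))` and noises `e_k ∼ N(0, diag(σε²))`,
    -- all independent
    (μ₀ : EuclideanSpace ℝ (Fin n)) (σ : Fin n → ℝ) (hσ : ∀ i, 0 < σ i)
    (σε : ℝ) (hσε : 0 ≤ σε)
    (W e : Fin K → Ω → EuclideanSpace ℝ (Fin n))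
    (hW : ∀ k, HasLaw (W k) (multivariateGaussian μ₀ (Matrix.diagonal fun i => σ i ^ 2)) Pr)
    (he : ∀ k, HasLaw (e k) (multivariateGaussian 0 (Matrix.diagonal fun _ => σε ^ 2)) Pr)
    (hindep : iIndepFun (Sum.elim W e) Pr)
    -- the adversary's beliefs
    (A : Fin K → PrivacyUtility.Adversary n X) (hξ : ∀ k, (A k).FiniteXi)
    -- the utility function and the distributions of the data sets
    (U : EuclideanSpace ℝ (Fin n) → X → ℝ) (hU : Measurable (Function.uncurry U))
    (C₄ : ℝ) (hC₄ : ∀ w x, U w x ∈ Set.Icc 0 C₄)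
    (Q : Fin K → Measure (PrivacyUtility.Dataset X)) (hQ : ∀ k, IsProbabilityMeasure (Q k))
    (hsmall : PrivacyUtility.noiseLevel σ σε ≤ 1) :
    -- `C₁ - C₃ σε² √(∑ᵢ 1/σᵢ⁴) ≤ ε_p`
    (PrivacyUtility.avgLeakage A (fun k => Pr.map (W k))
          - PrivacyUtility.constC3 A * PrivacyUtility.noiseLevel σ σε
        ≤ PrivacyUtility.avgLeakage A (fun k => Pr.map (fun ω => W k ω + e k ω))) ∧
    -- the lower bound is decreasing in the noise parameter
    AntitoneOn (fun s : ℝ => PrivacyUtility.avgLeakage A (fun k => Pr.map (W k))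
      - PrivacyUtility.constC3 A * PrivacyUtility.noiseLevel σ s) (Set.Ici 0) ∧
    (0 < PrivacyUtility.maxXi A →
      StrictAntiOn (fun s : ℝ => PrivacyUtility.avgLeakage A (fun k => Pr.map (W k))
        - PrivacyUtility.constC3 A * PrivacyUtility.noiseLevel σ s) (Set.Ici 0)) ∧
    -- `ε_u ≤ C₄ σε² √(∑ᵢ 1/σᵢ⁴)`
    (PrivacyUtility.utilityLoss U Q
          (Pr.map (fun ω => (K : ℝ)⁻¹ • ∑ k, W k ω))
          (Pr.map (fun ω => (K : ℝ)⁻¹ • ∑ k, (W k ω + e k ω)))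
        ≤ C₄ * PrivacyUtility.noiseLevel σ σε) ∧
    -- the upper bound is increasing in the noise parameter
    MonotoneOn (fun s : ℝ => C₄ * PrivacyUtility.noiseLevel σ s) (Set.Ici 0) ∧
    (0 < C₄ →
      StrictMonoOn (fun s : ℝ => C₄ * PrivacyUtility.noiseLevel σ s) (Set.Ici 0)) := by
  have hv : ∀ i, 0 ≤ σ i ^ 2 := fun i => sq_nonneg _
  have hK' : (K : ℝ) ≠ 0 := Nat.cast_ne_zero.2 hK.ne'
  have hKpos : (0 : ℝ) < (K : ℝ)⁻¹ := by positivity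
  have hh := PrivacyUtility.noiseLevel_nonneg σ σε
  have hC₃ := PrivacyUtility.constC3_nonneg A
  have hC₄0 : 0 ≤ C₄ := by
    have := hQ ⟨0, hK⟩
    obtain ⟨D⟩ : Nonempty (PrivacyUtility.Dataset X) :=
      nonempty_of_isProbabilityMeasure (Q ⟨0, hK⟩)
    obtain ⟨h1, h2⟩ := hC₄ 0 (D.2 0)
    exact h1.trans h2
  have hS : ∀ k, HasLaw (fun ω => W k ω + e k ω)
      (multivariateGaussian μ₀ (Matrix.diagonal fun i => σ i ^ 2 + σε ^ 2)) Pr := fun k => by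
    simpa using PrivacyUtility.hasLaw_add_gaussian hv (fun _ => sq_nonneg σε) (hW k) (he k)
      (hindep.indepFun (i := Sum.inl k) (j := Sum.inr k) (by simp))
  have hWind : iIndepFun W Pr := hindep.precomp (g := Sum.inl) Sum.inl_injective
  have haO : HasLaw (fun ω => (K : ℝ)⁻¹ • ∑ k, W k ω)
      (multivariateGaussian μ₀ (Matrix.diagonal fun i => (K : ℝ)⁻¹ * σ i ^ 2)) Pr := by
    convert! PrivacyUtility.hasLaw_smul_sum_gaussian (fun _ => hv) hW hWind (K : ℝ)⁻¹ using 3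
    · simp [← Nat.cast_smul_eq_nsmul ℝ, smul_smul, hK']
    · ext i
      simp
      field_simp
  have haS : HasLaw (fun ω => (K : ℝ)⁻¹ • ∑ k, (W k ω + e k ω))
      (multivariateGaussian μ₀ (Matrix.diagonal fun i => (K : ℝ)⁻¹ * (σ i ^ 2 + σε ^ 2))) Pr := by
    have h := PrivacyUtility.hasLaw_smul_sum_gaussian (Pr := Pr) (X := Sum.elim W e)
      (m := Sum.elim (fun _ => μ₀) fun _ => 0)
      (v := Sum.elim (fun _ i => σ i ^ 2) fun _ _ => σε ^ 2)
      (by rintro (k | k) i <;> exact sq_nonneg _) (by rintro (k | k); exacts [hW k, he k])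
      hindep (K : ℝ)⁻¹
    convert! h using 3
    · simp [Finset.sum_add_distrib]
    · simp [← Nat.cast_smul_eq_nsmul ℝ, smul_smul, hK']
    · ext i
      simp
      field_simp
  have hclose : ∀ c : ℝ, 0 < c → ∀ (g : EuclideanSpace ℝ (Fin n) → ℝ) (x y : ℝ), x ≤ y →
      Measurable g → (∀ w, g w ∈ Set.Icc x y) →
      |∫ w, g w ∂(multivariateGaussian μ₀ (Matrix.diagonal fun i => c * σ i ^ 2))
        - ∫ w, g w ∂(multivariateGaussian μ₀ (Matrix.diagonal fun i => c * (σ i ^ 2 + σε ^ 2)))|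
      ≤ (y - x) / 2 * PrivacyUtility.noiseLevel σ σε := fun c hc g x y hxy hg hgxy =>
    PrivacyUtility.abs_integral_sub_le_noiseLevel μ₀ hσ hc hsmall hxy hg hgxy
  refine ⟨?_, fun s hs t ht hst => ?_, fun hξ0 s hs t ht hst => ?_, ?_,
    fun s hs t ht hst => ?_, fun hC s hs t ht hst => ?_⟩
  · have hk : ∀ k, (A k).leakage (Pr.map (W k)) - (A k).leakage (Pr.map fun ω => W k ω + e k ω)
        ≤ PrivacyUtility.constC3 A * PrivacyUtility.noiseLevel σ σε := fun k => by
      rw [(hW k).map_eq, (hS k).map_eq, sub_le_iff_le_add']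
      exact PrivacyUtility.Adversary.leakage_le (hξ k) (PrivacyUtility.xi_le_maxXi A k) _ _ hh
        (by simpa only [one_mul] using hclose 1 one_pos)
    have := PrivacyUtility.inv_mul_sum_le hK hk
    rw [Finset.sum_sub_distrib, mul_sub] at this
    unfold PrivacyUtility.avgLeakage
    linarith
  · exact sub_le_sub_left (mul_le_mul_of_nonneg_left
      (PrivacyUtility.monotoneOn_noiseLevel σ hs ht hst) hC₃) _
  · exact sub_lt_sub_left (mul_lt_mul_of_pos_left
      (PrivacyUtility.strictMonoOn_noiseLevel hn hσ hs ht hst)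
      (PrivacyUtility.constC3_pos hξ0)) _
  · rw [haO.map_eq, haS.map_eq]
    exact PrivacyUtility.inv_mul_sum_le hK fun k =>
      PrivacyUtility.expectedUtility_sub_le hU hC₄0 hC₄ _ _ (Q k) hh (hclose _ hKpos)
  · exact mul_le_mul_of_nonneg_left (PrivacyUtility.monotoneOn_noiseLevel σ hs ht hst) hC₄0
  · exact mul_lt_mul_of_pos_left (PrivacyUtility.strictMonoOn_noiseLevel hn hσ hs ht hst) hC
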